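/- Let $m \ge 2$. For $\lambda = (\lambda_1, \dots, \lambda_m) \in (0,\infty)^m$ let $X_1, \dots, X_m, Y$ be independent random variables with $X_i \sim \mathrm{Po}(\lambda_i)$ for $i = 1, \dots, m$ and $Y \sim \mathrm{Po}\big(\sum_{i=1}^m \lambda_i\big)$, and write $X = (X_1, \dots, X_m)$ and $X_\cdot = \sum_{i=1}^m X_i$. Consider the estimation of $\lambda$ on the basis of $(X, Y)$ under the standardized squared loss $$L(d, \lambda) = \sum_{i=1}^m \frac{(d_i - \lambda_i)^2}{\lambda_i}, \qquad d \in \mathbb{R}^m.$$ Then the estimator $$\hat\lambda(X, Y) = \frac{X_\cdot + Y}{2} \, \frac{X}{X_\cdot + m - 1}$$ is admissible: there is no estimator $\delta \colon \mathbb{N}_0^m \times \mathbb{N}_0 \to \mathbb{R}^m$ such that $E_\lambda[L(\delta(X,Y), \lambda)] \le E_\lambda[L(\hat\lambda(X,Y), \lambda)]$ for all $\lambda \in (0,\infty)^m$, with strict inequality for at least one $\lambda \in (0,\infty)^m$. -/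

import Mathlib

open MeasureTheory ProbabilityTheory
open scoped ENNReal NNReal

namespace PoissonEstimation

/-- The parameter space `(0, ∞)^m`. -/
def paramSpace (m : ℕ) : Set (Fin m → ℝ) := {l | ∀ i, 0 < l i}

/-- The sample space: an outcome is a pair `(x, y)` with `x ∈ ℕ₀^m` and `y ∈ ℕ₀`. -/
abbrev Sample (m : ℕ) : Type := (Fin m → ℕ) × ℕ

/-- The joint law of `(X, Y)` under the parameter `l`: the coordinates `X i ∼ Po(l i)` and
`Y ∼ Po(∑ i, l i)` are all independent. (For `l` in the parameter space, `Real.toNNReal` only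
repackages a positive real number.) -/
noncomputable def sampleLaw {m : ℕ} (l : Fin m → ℝ) : Measure (Sample m) :=
  (Measure.pi fun i => poissonMeasure (l i).toNNReal).prod
    (poissonMeasure (∑ i, l i).toNNReal)

/-- The standardized squared loss `L(d, l) = ∑ i, (d i - l i)² / l i`. -/
noncomputable def loss {m : ℕ} (d l : Fin m → ℝ) : ℝ :=
  ∑ i, (d i - l i) ^ 2 / l i

/-- An estimator is a function of the data with values in `ℝ^m`; since the sample space is
countable and discrete, every such function is measurable. -/
abbrev Estimator (m : ℕ) : Type := Sample m → Fin m → ℝ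

/-- The risk `E_l[L(δ(X, Y), l)]`, with values in `[0, ∞]`. -/
noncomputable def risk {m : ℕ} (δ : Estimator m) (l : Fin m → ℝ) : ℝ≥0∞ :=
  ∫⁻ s, ENNReal.ofReal (loss (δ s) l) ∂(sampleLaw l)

/-- `δ'` dominates `δ`: its risk is nowhere larger, and somewhere strictly smaller, on the
parameter space. -/
def Dominates {m : ℕ} (δ' δ : Estimator m) : Prop :=
  (∀ l ∈ paramSpace m, risk δ' l ≤ risk δ l) ∧ ∃ l ∈ paramSpace m, risk δ' l < risk δ l

/-- An estimator is admissible if no estimator dominates it. -/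
def IsAdmissible {m : ℕ} (δ : Estimator m) : Prop :=
  ¬ ∃ δ' : Estimator m, Dominates δ' δ

/-- The estimator with coordinates `((x. + y) / 2) * (x i / (x. + m - 1))`, where
`x. = ∑ j, x j`. -/
noncomputable def shrinkageEstimator (m : ℕ) : Estimator m := fun s i =>
  (((∑ j, s.1 j : ℕ) : ℝ) + (s.2 : ℝ)) / 2 *
    ((s.1 i : ℝ) / (((∑ j, s.1 j : ℕ) : ℝ) + (m : ℝ) - 1))

end PoissonEstimation

namespace PoissonEstimation

/-! The proof shows more: an estimator whose risk is nowhere larger than that of the shrinkage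
estimator `e` equals `e`. Write `l = L • θ` with `θ` in the simplex and average the risks over
uniform `θ`, keeping `L` free. The Dirichlet moments make the average an explicit series over
outcomes. A nonzero estimate of coordinate `i` when `x i = 0` costs infinite average risk, so a
competitor `δ` must vanish there. For fixed `L` the posterior loss is quadratic in the action, with
minimizer `L * x i / (k + m - 1)`, `k` being the sum of the `x i`; the estimator `e` replaces `L` by
half the total count `n`.

Completing the square (`totalPosteriorLoss_sub`), the averaged risk difference times `L` is the mean
of `u + (n - 2 * L) * t`, where `t` is the sum of the coordinates of `δ - e` and `u` is a weighted
squared distance; Cauchy-Schwarz gives `t ^ 2 ≤ u` (`sq_sum_sub_le_sqDistance`).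

What remains is a one-parameter problem (`eq_zero_of_poisson_risk_nonpos`). Under the mixture `n` is
Poisson with mean `2 * L`, so `B L`, the mean of `t`, satisfies `L * B' L` = mean of `(n - 2 * L) *
t`. With Jensen, `B ^ 2 + L * B' ≤ 0` on the half line. In the variable `log L` this reads `C' ≤ -C
^ 2` on the whole line, whose nonzero solutions blow up in finite time. Hence `B = 0`, the mean of
`u` is zero, and `δ = e`. -/

/-! ### A Riccati inequality and the one-parameter Poisson problem -/

/-- A function on the whole line with `C' ≤ -C²` is nowhere positive. -/
lemma nonpos_of_hasDerivAt_le_neg_sq {C C' : ℝ → ℝ} (h : ∀ s, HasDerivAt C (C' s) s)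
    (hC : ∀ s, C' s ≤ -(C s) ^ 2) (s₀ : ℝ) : C s₀ ≤ 0 := by
  by_contra! hpos
  have hanti : Antitone C := antitone_of_hasDerivAt_nonpos h fun s => by
    have := hC s
    simp only [Pi.zero_apply]
    nlinarith [sq_nonneg (C s)]
  have hp : ∀ s ≤ s₀, 0 < C s := fun s hs => hpos.trans_le (hanti hs)
  -- While `C` is positive, `1 / C` has slope at least one; going back from `s₀` by `1 / C s₀` would
  -- bring it down to zero or below.
  have hd : ∀ s ≤ s₀, HasDerivAt (fun s => (C s)⁻¹ - s) (-C' s / C s ^ 2 - 1) s := fun s hs =>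
    ((h s).inv (hp s hs).ne').sub (hasDerivAt_id s)
  have hm : MonotoneOn (fun s => (C s)⁻¹ - s) (Set.Iic s₀) := by
    have hsub : ∀ s ∈ interior (Set.Iic s₀), s ≤ s₀ := fun s hs => Set.mem_Iic.1 (interior_subset hs)
    refine monotoneOn_of_deriv_nonneg (convex_Iic _)
      (fun s hs => (hd s hs).continuousAt.continuousWithinAt)
      (fun s hs => (hd s (hsub s hs)).differentiableAt.differentiableWithinAt) fun s hs => ?_
    have hs' := hsub s hs
    rw [(hd s hs').deriv, sub_nonneg, le_div_iff₀ (pow_pos (hp s hs') 2)]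
    linarith [hC s]
  have hinv : 0 < (C s₀)⁻¹ := inv_pos.2 hpos
  have hle : s₀ - (C s₀)⁻¹ ≤ s₀ := by linarith
  have h1 := hm (Set.mem_Iic.2 hle) (Set.mem_Iic.2 le_rfl) hle
  have h2 := inv_pos.2 (hp _ hle)
  simp only at h1
  linarith

/-- The only global solution of `C' ≤ -C²` is zero. -/
lemma eq_zero_of_hasDerivAt_le_neg_sq {C C' : ℝ → ℝ} (h : ∀ s, HasDerivAt C (C' s) s)
    (hC : ∀ s, C' s ≤ -(C s) ^ 2) (s : ℝ) : C s = 0 := by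
  refine le_antisymm (nonpos_of_hasDerivAt_le_neg_sq h hC s) ?_
  -- The inequality is invariant under `C s ↦ -C (-s)`.
  have h' : ∀ x, HasDerivAt (fun x => -C (-x)) (C' (-x)) x := fun x => by
    have := ((h (-x)).scomp x (hasDerivAt_neg x)).fun_neg
    simpa using this
  have := nonpos_of_hasDerivAt_le_neg_sq h' (fun x => by simpa using hC (-x)) (-s)
  simpa using this

/-- The only solution of `B² + x B' ≤ 0` on the half line is zero. -/
lemma eq_zero_of_sq_add_mul_hasDerivAt_nonpos {B B' : ℝ → ℝ}
    (h : ∀ x, 0 < x → HasDerivAt B (B' x) x) (hB : ∀ x, 0 < x → B x ^ 2 + x * B' x ≤ 0)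
    {x : ℝ} (hx : 0 < x) : B x = 0 := by
  have h1 : ∀ s, HasDerivAt (fun s => B (Real.exp s)) (B' (Real.exp s) * Real.exp s) s :=
    fun s => (h _ (Real.exp_pos s)).comp s (Real.hasDerivAt_exp s)
  have := eq_zero_of_hasDerivAt_le_neg_sq h1 (fun s => by
    linarith [hB _ (Real.exp_pos s)]) (Real.log x)
  simpa [Real.exp_log hx] using this

/-- Differentiation of a generalized power series with nonnegative real variable. -/
lemma hasDerivAt_tsum_mul_pow {ι : Type*} {a : ι → ℝ} {n : ι → ℕ}
    (ha : ∀ x, 0 < x → Summable fun s => |a s| * x ^ n s) {x : ℝ} (hx : 0 < x) :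
    HasDerivAt (fun x => ∑' s, a s * x ^ n s) (∑' s, a s * (n s * x ^ (n s - 1))) x := by
  -- The radius `2 * (x + 1)` bounds `y`; the further factor `2` absorbs `n s ≤ 2 ^ n s`.
  have hb : Summable fun s => (|a s| * (2 * (2 * (x + 1))) ^ n s) := ha _ (by positivity)
  refine hasDerivAt_tsum_of_isPreconnected (t := Set.Ioo 0 (2 * (x + 1))) (y₀ := x) hb isOpen_Ioo
    isPreconnected_Ioo (fun s y _ => (hasDerivAt_pow (n s) y).const_mul (a s)) ?_ ?_ ?_ ?_
  · intro s y hy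
    have h1 : (1 : ℝ) ≤ 2 * (x + 1) := by linarith
    have h2 : y ^ (n s - 1) ≤ (2 * (x + 1)) ^ n s :=
      (pow_le_pow_left₀ hy.1.le hy.2.le _).trans (pow_le_pow_right₀ h1 (Nat.sub_le _ _))
    have h3 : (n s : ℝ) ≤ 2 ^ n s := by exact_mod_cast Nat.lt_two_pow_self.le
    have h4 := hy.1
    rw [Real.norm_eq_abs, abs_mul, mul_pow, abs_of_nonneg (by positivity : 0 ≤ (n s : ℝ) * y ^ (n s - 1))]
    gcongr
  · exact ⟨hx, by linarith⟩
  · refine Summable.of_norm ?_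
    simpa [abs_mul, abs_of_pos hx] using ha x hx
  · exact ⟨hx, by linarith⟩

/-- Uniqueness in the one-parameter Poisson problem: if weights `w` sum to `exp (2 x)` against
`x ^ n`, `t² ≤ u`, and the risk difference is nowhere positive, then `u` vanishes. -/
lemma eq_zero_of_poisson_risk_nonpos {ι : Type*} {w t u : ι → ℝ} {n : ι → ℕ}
    (hw : ∀ s, 0 < w s) (htu : ∀ s, t s ^ 2 ≤ u s)
    (hsum : ∀ x, 0 < x → HasSum (fun s => w s * x ^ n s) (Real.exp (2 * x)))
    (hu : ∀ x, 0 < x → Summable fun s => w s * u s * x ^ n s)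
    (hle : ∀ x, 0 < x → ∑' s, w s * x ^ n s * (u s + (n s - 2 * x) * t s) ≤ 0) (s : ι) :
    u s = 0 := by
  have hu0 : ∀ s, 0 ≤ u s := fun s => (sq_nonneg _).trans (htu s)
  have hta : ∀ x, 0 < x → Summable fun s => |w s * t s| * x ^ n s := fun x hx => by
    refine Summable.of_nonneg_of_le (fun s => by positivity) (fun s => ?_)
      ((hsum x hx).summable.add (hu x hx))
    have : |t s| ≤ 1 + u s := by nlinarith [htu s, sq_abs (t s), sq_nonneg (|t s| - 1), abs_nonneg (t s)]
    rw [abs_mul, abs_of_pos (hw s)]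
    have h1 : 0 < w s * x ^ n s := mul_pos (hw s) (pow_pos hx _)
    nlinarith
  have ht : ∀ x, 0 < x → Summable fun s => w s * t s * x ^ n s := fun x hx => by
    refine Summable.of_norm ?_
    simpa [abs_mul, abs_of_pos hx] using hta x hx
  have hnt : ∀ x, 0 < x → Summable fun s => w s * t s * (n s * x ^ n s) := fun x hx => by
    refine Summable.of_norm_bounded (hta (2 * x) (by positivity)) (fun s => ?_)
    have h3 : (n s : ℝ) ≤ 2 ^ n s := by exact_mod_cast Nat.lt_two_pow_self.le
    rw [Real.norm_eq_abs, abs_mul, mul_pow,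
      abs_of_nonneg (by positivity : 0 ≤ (n s : ℝ) * x ^ n s)]
    gcongr
  have ht2 : ∀ x, 0 < x → Summable fun s => w s * t s ^ 2 * x ^ n s := fun x hx => by
    refine Summable.of_nonneg_of_le (fun s => ?_) (fun s => ?_) (hu x hx)
    · have := hw s
      positivity
    · have := hw s
      have := htu s
      gcongr
  set F : ℝ → ℝ := fun x => ∑' s, w s * t s * x ^ n s with hF
  set G : ℝ → ℝ := fun x => ∑' s, w s * t s * (n s * x ^ n s) with hG
  set U : ℝ → ℝ := fun x => ∑' s, w s * u s * x ^ n s with hU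
  have hFd : ∀ x, 0 < x → HasDerivAt F (G x / x) x := fun x hx => by
    convert hasDerivAt_tsum_mul_pow hta hx using 1
    rw [hG, ← tsum_div_const]
    refine tsum_congr fun s => ?_
    rcases Nat.eq_zero_or_pos (n s) with h | h
    · simp [h]
    · obtain ⟨k, hk⟩ := Nat.exists_eq_succ_of_ne_zero h.ne'
      rw [hk, Nat.succ_sub_one, pow_succ]
      field_simp
  have hineq : ∀ x, 0 < x → U x + G x - 2 * x * F x ≤ 0 := fun x hx => by
    refine le_trans (le_of_eq ?_) (hle x hx)
    rw [hU, hG, hF]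
    simp only
    rw [← tsum_mul_left, ← (hu x hx).tsum_add (hnt x hx),
      ← ((hu x hx).add (hnt x hx)).tsum_sub ((ht x hx).mul_left _)]
    exact tsum_congr fun s => by ring
  -- Jensen: the weights `exp (-2x) * w s * x ^ n s` sum to one, `b` is the mean of `t`, and the
  -- variance of `t` is nonnegative.
  have hsq : ∀ x, 0 < x → Real.exp (-(2 * x)) * F x ^ 2 ≤ U x := fun x hx => by
    set b := Real.exp (-(2 * x)) * F x with hb
    have h1 : ∑' s, (w s * t s ^ 2 * x ^ n s - 2 * b * (w s * t s * x ^ n s)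
        + b ^ 2 * (w s * x ^ n s)) = ∑' s, w s * t s ^ 2 * x ^ n s - 2 * b * F x
          + b ^ 2 * Real.exp (2 * x) := by
      rw [(((ht2 x hx).sub ((ht x hx).mul_left _)).tsum_add ((hsum x hx).summable.mul_left _)),
        (ht2 x hx).tsum_sub ((ht x hx).mul_left _), tsum_mul_left, tsum_mul_left,
        (hsum x hx).tsum_eq]
    have h2 : 0 ≤ ∑' s, (w s * t s ^ 2 * x ^ n s - 2 * b * (w s * t s * x ^ n s)
        + b ^ 2 * (w s * x ^ n s)) := tsum_nonneg fun s => by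
      have : 0 ≤ w s * x ^ n s * (t s - b) ^ 2 :=
        mul_nonneg (mul_pos (hw s) (pow_pos hx _)).le (sq_nonneg _)
      linarith
    have h3 : ∑' s, w s * t s ^ 2 * x ^ n s ≤ U x :=
      (ht2 x hx).tsum_le_tsum (fun s => by
        have := hw s
        have := htu s
        gcongr) (hu x hx)
    have h4 : b ^ 2 * Real.exp (2 * x) = b * F x := by
      have : Real.exp (-(2 * x)) * Real.exp (2 * x) = 1 := by rw [← Real.exp_add]; simp
      calc b ^ 2 * Real.exp (2 * x) = b * F x * (Real.exp (-(2 * x)) * Real.exp (2 * x)) := by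
            rw [hb]; ring
        _ = b * F x := by rw [this, mul_one]
    have h5 : Real.exp (-(2 * x)) * F x ^ 2 = b * F x := by rw [hb]; ring
    linarith
  have hBd : ∀ x, 0 < x → HasDerivAt (fun x => Real.exp (-(2 * x)) * F x)
      (Real.exp (-(2 * x)) * (G x / x - 2 * F x)) x := fun x hx => by
    have h1 : HasDerivAt (fun x : ℝ => Real.exp (-(2 * x))) (Real.exp (-(2 * x)) * (-(2 * 1))) x :=
      ((hasDerivAt_id x).const_mul 2).neg.exp
    exact (h1.mul (hFd x hx)).congr_deriv (by ring)
  have hxB : ∀ x, 0 < x → x * (Real.exp (-(2 * x)) * (G x / x - 2 * F x)) =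
      Real.exp (-(2 * x)) * (G x - 2 * x * F x) := fun x hx => by
    field_simp
  have hF0 : ∀ x, 0 < x → F x = 0 := fun x hx => by
    have := eq_zero_of_sq_add_mul_hasDerivAt_nonpos hBd (fun y hy => ?_) hx
    · simpa using this
    · rw [hxB y hy]
      have h1 := hsq y hy
      have h2 := hineq y hy
      have h3 := Real.exp_pos (-(2 * y))
      nlinarith
  have hG0 : G 1 = 0 := by
    have h1 : HasDerivAt F 0 1 := (hasDerivAt_const (1 : ℝ) (0 : ℝ)).congr_of_eventuallyEq <| by
      filter_upwards [lt_mem_nhds (zero_lt_one' ℝ)] with y hy using hF0 y hy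
    simpa using (hFd 1 one_pos).unique h1
  have hU1 : U 1 ≤ 0 := by
    have := hineq 1 one_pos
    rw [hG0, hF0 1 one_pos] at this
    linarith
  have h1 : w s * u s * 1 ^ n s ≤ U 1 := (hu 1 one_pos).le_tsum s fun j _ => by
    have := (hw j).le
    have := hu0 j
    positivity
  rw [one_pow, mul_one] at h1
  have := hw s
  nlinarith [hu0 s]

/-! ### Integrals against the exponential law -/

lemma lintegral_expMeasure_one {f : ℝ → ℝ≥0∞} (hf : Measurable f) :
    ∫⁻ u, f u ∂(expMeasure 1) = ∫⁻ u in Set.Ioi 0, ENNReal.ofReal (Real.exp (-u)) * f u := by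
  have hm : Measurable (gammaPDF 1 1) := (measurable_gammaPDFReal 1 1).ennreal_ofReal
  rw [expMeasure, gammaMeasure, lintegral_withDensity_eq_lintegral_mul _ hm hf,
    ← lintegral_add_compl _ measurableSet_Ici (A := Set.Ici (0 : ℝ)), Set.compl_Ici]
  have h1 : ∫⁻ u in Set.Iio 0, (gammaPDF 1 1 * f) u = 0 := by
    rw [setLIntegral_congr_fun measurableSet_Iio (g := fun _ => 0)
      (fun u (hu : u < 0) => by simp [gammaPDF_of_neg hu]), lintegral_zero]
  rw [h1, add_zero, setLIntegral_congr Ioi_ae_eq_Ici.symm]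
  exact setLIntegral_congr_fun measurableSet_Ioi fun u (hu : 0 < u) => by
    simp [gammaPDF_of_nonneg hu.le]

instance : IsProbabilityMeasure (expMeasure 1) := isProbabilityMeasure_expMeasure one_pos

lemma ae_pos_expMeasure_one : ∀ᵐ u ∂(expMeasure 1), 0 < u := by
  have h : MeasurableSet {u : ℝ | ¬ 0 < u} := (measurableSet_lt measurable_const measurable_id).compl
  rw [ae_iff, ← lintegral_indicator_one h, lintegral_expMeasure_one (measurable_one.indicator h),
    setLIntegral_congr_fun measurableSet_Ioi (g := fun _ => 0), lintegral_zero]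
  intro u (hu : 0 < u)
  simp [hu]

lemma lintegral_pow_mul_exp_neg (n : ℕ) {r : ℝ} (hr : 0 < r) :
    ∫⁻ u in Set.Ioi 0, ENNReal.ofReal (u ^ n * Real.exp (-(r * u)))
      = ENNReal.ofReal (n.factorial / r ^ (n + 1)) := by
  have h := Real.integral_rpow_mul_exp_neg_mul_Ioi (a := n + 1) (r := r) (by positivity) hr
  have h' : ∫ u in Set.Ioi 0, u ^ n * Real.exp (-(r * u)) = n.factorial / r ^ (n + 1) := by
    have e : (1 / r) ^ ((n : ℝ) + 1) * Real.Gamma (n + 1) = n.factorial / r ^ (n + 1) := by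
      rw [Real.Gamma_nat_eq_factorial]
      have : (n : ℝ) + 1 = ((n + 1 : ℕ) : ℝ) := by push_cast; ring
      rw [this, Real.rpow_natCast, one_div, inv_pow]
      ring
    rw [← e, ← h]
    refine setIntegral_congr_fun measurableSet_Ioi fun u _ => ?_
    simp
  have hi : Integrable (fun u => u ^ n * Real.exp (-(r * u))) (volume.restrict (Set.Ioi 0)) :=
    .of_integral_ne_zero (by rw [h']; positivity)
  rw [← h', ofReal_integral_eq_lintegral_ofReal hi]
  rw [Filter.EventuallyLE, ae_restrict_iff' measurableSet_Ioi]
  exact ae_of_all _ fun u (hu : 0 < u) => by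
    simp only [Pi.zero_apply]
    positivity

lemma lintegral_inv_mul_exp_neg (r : ℝ) (hr : 0 < r) :
    ∫⁻ u in Set.Ioi 0, ENNReal.ofReal (u⁻¹ * Real.exp (-(r * u))) = ∞ := by
  by_contra hne
  have hlt : ∫⁻ u in Set.Ioc 0 1, ENNReal.ofReal (u⁻¹) < ∞ := by
    calc ∫⁻ u in Set.Ioc 0 1, ENNReal.ofReal (u⁻¹)
        ≤ ∫⁻ u in Set.Ioc 0 1, ENNReal.ofReal (Real.exp r) *
            ENNReal.ofReal (u⁻¹ * Real.exp (-(r * u))) := by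
          refine setLIntegral_mono' measurableSet_Ioc fun u hu => ?_
          rw [← ENNReal.ofReal_mul (Real.exp_pos r).le]
          refine ENNReal.ofReal_le_ofReal ?_
          have h1 : 0 < u⁻¹ := inv_pos.2 hu.1
          have h2 : 1 ≤ Real.exp r * Real.exp (-(r * u)) := by
            rw [← Real.exp_add]
            refine Real.one_le_exp ?_
            nlinarith [hu.2]
          nlinarith
      _ ≤ ∫⁻ u in Set.Ioi 0, ENNReal.ofReal (Real.exp r) *
            ENNReal.ofReal (u⁻¹ * Real.exp (-(r * u))) :=
          lintegral_mono_set Set.Ioc_subset_Ioi_self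
      _ = ENNReal.ofReal (Real.exp r) *
            ∫⁻ u in Set.Ioi 0, ENNReal.ofReal (u⁻¹ * Real.exp (-(r * u))) :=
          lintegral_const_mul _ (by fun_prop)
      _ < ∞ := ENNReal.mul_lt_top ENNReal.ofReal_lt_top (lt_top_iff_ne_top.2 hne)
  have hint : IntegrableOn (fun u : ℝ => u⁻¹) (Set.Ioc 0 1) := by
    refine ⟨(by fun_prop), ?_⟩
    rw [hasFiniteIntegral_iff_ofReal]
    · exact hlt
    · rw [Filter.EventuallyLE, ae_restrict_iff' measurableSet_Ioc]
      exact ae_of_all _ fun u hu => inv_nonneg.2 hu.1.le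
  have := (intervalIntegrable_iff_integrableOn_Ioc_of_le zero_le_one).2 hint
  simp [intervalIntegrable_inv_iff] at this

/-! ### The uniform distribution on the simplex and its moments -/

/-- The law of `m` independent standard exponential variables. -/
noncomputable abbrev expProd (m : ℕ) : Measure (Fin m → ℝ) := Measure.pi fun _ => expMeasure 1

lemma lintegral_expProd_prod {m : ℕ} {f : Fin m → ℝ → ℝ≥0∞} (hf : ∀ i, Measurable (f i)) :
    ∫⁻ v, ∏ i, f i (v i) ∂(expProd m) = ∏ i, ∫⁻ u, f i u ∂(expMeasure 1) := by
  have h := lintegral_prod_eq_prod_lintegral_of_indepFun (μ := expProd m) Finset.univ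
    (fun i v => f i (v i)) (iIndepFun_pi fun i => (hf i).aemeasurable)
    (fun i => (hf i).comp (measurable_pi_apply i))
  rw [h]
  refine Finset.prod_congr rfl fun i _ => ?_
  exact (measurePreserving_eval (fun _ : Fin m => expMeasure 1) i).lintegral_comp (hf i)

lemma ae_pos_expProd (m : ℕ) : ∀ᵐ v ∂(expProd m), ∀ i, 0 < v i :=
  ae_all_iff.2 fun i =>
    (measurePreserving_eval (fun _ : Fin m => expMeasure 1) i).quasiMeasurePreserving.ae
      ae_pos_expMeasure_one

/-- The vector `v` divided by the sum of its coordinates. -/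
noncomputable def normalize {m : ℕ} (v : Fin m → ℝ) : Fin m → ℝ := fun i => v i / ∑ j, v j

lemma measurable_normalize (m : ℕ) : Measurable (normalize (m := m)) :=
  measurable_pi_lambda _ fun i => by unfold normalize; fun_prop

/-- The uniform distribution on the probability simplex. -/
noncomputable def uniformSimplex (m : ℕ) : Measure (Fin m → ℝ) := (expProd m).map normalize

instance (m : ℕ) : IsProbabilityMeasure (uniformSimplex m) :=
  Measure.isProbabilityMeasure_map (measurable_normalize m).aemeasurable

lemma ae_uniformSimplex {m : ℕ} (hm : 0 < m) :
    ∀ᵐ θ ∂(uniformSimplex m), (∀ i, 0 < θ i) ∧ ∑ i, θ i = 1 := by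
  have : NeZero m := ⟨hm.ne'⟩
  have hs : MeasurableSet {θ : Fin m → ℝ | (∀ i, 0 < θ i) ∧ ∑ i, θ i = 1} := by measurability
  rw [uniformSimplex, ae_map_iff (measurable_normalize m).aemeasurable hs]
  filter_upwards [ae_pos_expProd m] with v hv
  have hS : 0 < ∑ j, v j := Finset.sum_pos (fun i _ => hv i) Finset.univ_nonempty
  refine ⟨fun i => div_pos (hv i) hS, ?_⟩
  simp only [normalize]
  rw [← Finset.sum_div, div_self hS.ne']

/-- The multi-index `x` with its coordinate `i` increased by one. -/
def incr {m : ℕ} (x : Fin m → ℕ) (i : Fin m) : Fin m → ℕ := x + Pi.single i 1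

lemma sum_incr {m : ℕ} (x : Fin m → ℕ) (i : Fin m) :
    ∑ j, incr x i j = ∑ j, x j + 1 := by
  simp [incr, Finset.sum_add_distrib]

lemma prod_pow_incr {m : ℕ} (x : Fin m → ℕ) (i : Fin m) (θ : Fin m → ℝ) :
    ∏ j, θ j ^ incr x i j = θ i * ∏ j, θ j ^ x j := by
  simp only [incr, Pi.add_apply, pow_add, Finset.prod_mul_distrib]
  rw [mul_comm, Finset.prod_eq_single i (by intro j _ hj; simp [hj]) (by simp)]
  simp

lemma prod_factorial_incr {m : ℕ} (x : Fin m → ℕ) (i : Fin m) :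
    ∏ j, ((incr x i j).factorial : ℝ) = (x i + 1) * ∏ j, ((x j).factorial : ℝ) := by
  have h : ∀ j, ((incr x i j).factorial : ℝ) =
      (if j = i then (x i + 1 : ℝ) else 1) * ((x j).factorial : ℝ) := fun j => by
    by_cases hj : j = i
    · subst hj
      simp [incr, Nat.factorial_succ]
    · simp [incr, hj]
  simp only [h, Finset.prod_mul_distrib, Finset.prod_ite_eq', Finset.mem_univ, if_true]

/-- The dependence of the monomial moments of the uniform distribution on the total degree. -/
noncomputable def momentFactor (m k : ℕ) : ℝ≥0∞ :=
  if k = 0 then 1 else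
    ∫⁻ t in Set.Ioi (0 : ℝ), ENNReal.ofReal (t ^ (k - 1) / (k - 1).factorial / (1 + t) ^ (k + m))

lemma lintegral_expProd_monomial_exp {m : ℕ} (x : Fin m → ℕ) {t : ℝ} (ht : 0 < t) :
    ∫⁻ v, ∏ i, ENNReal.ofReal (v i ^ x i * Real.exp (-(t * v i))) ∂(expProd m) =
      ENNReal.ofReal (∏ i, ((x i).factorial : ℝ)) *
        ENNReal.ofReal (1 / (1 + t) ^ (∑ i, x i + m)) := by
  rw [lintegral_expProd_prod (f := fun i u => ENNReal.ofReal (u ^ x i * Real.exp (-(t * u))))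
    (fun i => by fun_prop)]
  have h1 : ∀ i, ∫⁻ u, ENNReal.ofReal (u ^ x i * Real.exp (-(t * u))) ∂(expMeasure 1) =
      ENNReal.ofReal ((x i).factorial / (1 + t) ^ (x i + 1)) := fun i => by
    rw [lintegral_expMeasure_one (by fun_prop), ← lintegral_pow_mul_exp_neg _ (by linarith)]
    refine lintegral_congr fun u => ?_
    rw [← ENNReal.ofReal_mul (Real.exp_pos _).le]
    congr 1
    rw [mul_left_comm, ← Real.exp_add]
    congr 2
    ring
  have ht' : 0 < 1 + t := by linarith
  simp only [h1]
  rw [← ENNReal.ofReal_prod_of_nonneg (fun i _ => by positivity), ← ENNReal.ofReal_mul (by positivity)]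
  congr 1
  rw [Finset.prod_div_distrib, Finset.prod_pow_eq_pow_sum, Finset.sum_add_distrib]
  simp [div_eq_mul_inv]

/-- With `S = ∑ j, v j` and total degree `k > 0`, the Gamma integral of `t ^ (k - 1) * exp (-(t *
S))` replaces `S ^ (-k)` and decouples the coordinates. Each one contributes `(x i)! / (1 + t) ^ (x
i + 1)`, so apart from the factorials only the total degree matters. -/
lemma lintegral_monomial_eq_momentFactor {m : ℕ} (x : Fin m → ℕ) :
    ∫⁻ θ, ENNReal.ofReal (∏ i, θ i ^ x i) ∂(uniformSimplex m) =
      ENNReal.ofReal (∏ i, ((x i).factorial : ℝ)) * momentFactor m (∑ i, x i) := by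
  rcases Nat.eq_zero_or_pos (∑ i, x i) with hk | hk
  · have hx : ∀ i, x i = 0 := fun i => by simpa using (Finset.sum_eq_zero_iff.1 hk) i
    simp [momentFactor, hx]
  obtain ⟨k, hk⟩ := Nat.exists_eq_succ_of_ne_zero hk.ne'
  have hm : 0 < m := by
    rcases Nat.eq_zero_or_pos m with rfl | h
    · simp at hk
    · exact h
  have : NeZero m := ⟨hm.ne'⟩
  rw [hk, momentFactor, if_neg (Nat.succ_ne_zero k), Nat.succ_sub_one, uniformSimplex,
    lintegral_map (by fun_prop) (measurable_normalize m)]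
  have h1 : ∀ᵐ v ∂(expProd m), ENNReal.ofReal (∏ i, normalize v i ^ x i) =
      ∫⁻ t in Set.Ioi (0 : ℝ), ENNReal.ofReal (t ^ k / k.factorial) *
        ∏ i, ENNReal.ofReal (v i ^ x i * Real.exp (-(t * v i))) := by
    filter_upwards [ae_pos_expProd m] with v hv
    have hS : 0 < ∑ j, v j := Finset.sum_pos (fun i _ => hv i) Finset.univ_nonempty
    have hP : 0 < ∏ i, v i ^ x i := Finset.prod_pos fun i _ => pow_pos (hv i) _
    have e1 : ∏ i, normalize v i ^ x i =
        ((∏ i, v i ^ x i) / k.factorial) * (k.factorial / (∑ j, v j) ^ (k + 1)) := by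
      simp only [normalize, div_pow, Finset.prod_div_distrib, Finset.prod_pow_eq_pow_sum, hk]
      have : (k.factorial : ℝ) ≠ 0 := by positivity
      field_simp
    rw [e1, ENNReal.ofReal_mul (by positivity), ← lintegral_pow_mul_exp_neg k hS,
      ← lintegral_const_mul _ (by fun_prop)]
    refine setLIntegral_congr_fun measurableSet_Ioi fun t (ht : 0 < t) => ?_
    rw [← ENNReal.ofReal_prod_of_nonneg (fun i _ => by have := hv i; positivity),
      ← ENNReal.ofReal_mul (by positivity), ← ENNReal.ofReal_mul (by positivity),
      Finset.prod_mul_distrib, ← Real.exp_sum, Finset.sum_neg_distrib, ← Finset.mul_sum,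
      mul_comm t]
    congr 1
    ring
  rw [lintegral_congr_ae h1, lintegral_lintegral_swap (by fun_prop),
    ← lintegral_const_mul _ (by fun_prop)]
  refine setLIntegral_congr_fun measurableSet_Ioi fun t (ht : 0 < t) => ?_
  rw [lintegral_const_mul _ (by fun_prop), lintegral_expProd_monomial_exp x ht, hk, mul_left_comm,
    ← ENNReal.ofReal_mul (by positivity)]
  congr 2
  ring

/-- Since `∑ i, θ i = 1`, a moment is the sum of the moments with one exponent raised, and the
factors `x i + 1` add up to `k + m`. This recursion replaces an evaluation of the integral in
`momentFactor`. -/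
lemma momentFactor_succ {m : ℕ} (hm : 0 < m) (k : ℕ) :
    momentFactor m (k + 1) * ENNReal.ofReal (k + m) = momentFactor m k := by
  have : NeZero m := ⟨hm.ne'⟩
  -- Any multi-index of total degree `k` would serve.
  set x : Fin m → ℕ := Pi.single 0 k with hx
  have hxs : ∑ i, x i = k := by simp [hx]
  set P : ℝ := ∏ i, ((x i).factorial : ℝ) with hP
  have hP0 : 0 < P := Finset.prod_pos fun i _ => by positivity
  have h1 : ∫⁻ θ, ENNReal.ofReal (∏ i, θ i ^ x i) ∂(uniformSimplex m) =
      ∑ i, ∫⁻ θ, ENNReal.ofReal (∏ j, θ j ^ incr x i j) ∂(uniformSimplex m) := by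
    rw [← lintegral_finsetSum _ (fun i _ => by fun_prop)]
    refine lintegral_congr_ae ?_
    filter_upwards [ae_uniformSimplex hm] with θ hθ
    have : 0 ≤ ∏ j, θ j ^ x j := Finset.prod_nonneg fun j _ => pow_nonneg (hθ.1 j).le _
    simp only [prod_pow_incr]
    rw [← ENNReal.ofReal_sum_of_nonneg (fun i _ => mul_nonneg (hθ.1 i).le this),
      ← Finset.sum_mul, hθ.2, one_mul]
  simp only [lintegral_monomial_eq_momentFactor, sum_incr, prod_factorial_incr, hxs]
    at h1
  rw [← Finset.sum_mul, ← ENNReal.ofReal_sum_of_nonneg (fun i _ => by positivity),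
    ← Finset.sum_mul, Finset.sum_add_distrib, ← Nat.cast_sum, hxs, mul_comm _ (∏ i, _),
    ENNReal.ofReal_mul hP0.le, mul_assoc] at h1
  have h2 := (ENNReal.mul_right_inj (by simpa using hP0) ENNReal.ofReal_ne_top).1 h1
  rw [h2, mul_comm]
  simp

/-- The probability `(m-1)! / (k+m-1)!`, up to multinomial normalization, of an outcome of total
`k` under the uniform mixture of multinomial distributions. -/
noncomputable def mixtureWeight (m k : ℕ) : ℝ := (m - 1).factorial / (k + m - 1).factorial

lemma mixtureWeight_pos (m k : ℕ) : 0 < mixtureWeight m k := by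
  unfold mixtureWeight
  positivity

lemma mixtureWeight_succ {m : ℕ} (hm : 0 < m) (k : ℕ) :
    mixtureWeight m k = mixtureWeight m (k + 1) * (k + m) := by
  unfold mixtureWeight
  obtain ⟨n, rfl⟩ := Nat.exists_eq_succ_of_ne_zero hm.ne'
  rw [show k + 1 + (n + 1) - 1 = (k + n) + 1 by omega, show k + (n + 1) - 1 = k + n by omega,
    Nat.factorial_succ]
  push_cast
  have : (k : ℝ) + n + 1 ≠ 0 := by positivity
  have : ((k + n).factorial : ℝ) ≠ 0 := by positivity
  field_simp
  ring

lemma momentFactor_eq {m : ℕ} (hm : 0 < m) (k : ℕ) :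
    momentFactor m k = ENNReal.ofReal (mixtureWeight m k) := by
  induction k with
  | zero =>
    have : ((m - 1).factorial : ℝ) ≠ 0 := by positivity
    simp [momentFactor, mixtureWeight, this]
  | succ k ih =>
    have h := momentFactor_succ hm k
    have hpos : (0 : ℝ) < k + m := by positivity
    rw [ih, mixtureWeight_succ hm, ENNReal.ofReal_mul (mixtureWeight_pos _ _).le] at h
    exact (ENNReal.mul_left_inj (by simpa using hpos) ENNReal.ofReal_ne_top).1 h

lemma lintegral_monomial {m : ℕ} (hm : 0 < m) (x : Fin m → ℕ) :
    ∫⁻ θ, ENNReal.ofReal (∏ i, θ i ^ x i) ∂(uniformSimplex m) =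
      ENNReal.ofReal ((∏ i, ((x i).factorial : ℝ)) * mixtureWeight m (∑ i, x i)) := by
  rw [lintegral_monomial_eq_momentFactor, momentFactor_eq hm, ENNReal.ofReal_mul (by positivity)]

lemma ae_monomial_nonneg {m : ℕ} (hm : 0 < m) (x : Fin m → ℕ) :
    0 ≤ᵐ[uniformSimplex m] fun θ => ∏ i, θ i ^ x i := by
  filter_upwards [ae_uniformSimplex hm] with θ hθ
  exact Finset.prod_nonneg fun j _ => pow_nonneg (hθ.1 j).le _

lemma aestronglyMeasurable_monomial {m : ℕ} (x : Fin m → ℕ) :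
    AEStronglyMeasurable (fun θ => ∏ i, θ i ^ x i) (uniformSimplex m) :=
  (by fun_prop : Measurable fun θ : Fin m → ℝ => ∏ i, θ i ^ x i).aestronglyMeasurable

lemma integrable_monomial {m : ℕ} (hm : 0 < m) (x : Fin m → ℕ) :
    Integrable (fun θ => ∏ i, θ i ^ x i) (uniformSimplex m) := by
  refine ⟨aestronglyMeasurable_monomial x, ?_⟩
  rw [hasFiniteIntegral_iff_ofReal (ae_monomial_nonneg hm x), lintegral_monomial hm]
  exact ENNReal.ofReal_lt_top

lemma integral_monomial {m : ℕ} (hm : 0 < m) (x : Fin m → ℕ) :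
    ∫ θ, ∏ i, θ i ^ x i ∂(uniformSimplex m) =
      (∏ i, ((x i).factorial : ℝ)) * mixtureWeight m (∑ i, x i) := by
  rw [integral_eq_lintegral_of_nonneg_ae (ae_monomial_nonneg hm x) (aestronglyMeasurable_monomial x),
    lintegral_monomial hm, ENNReal.toReal_ofReal]
  exact mul_nonneg (by positivity) (mixtureWeight_pos _ _).le

/-- Divergence comes from the face `θ i = 0`. With `S = ∑ j, v j`, the integrand is `(∏ j, v j ^ x
j) / v i * S * S ^ (-k)`. The bounds `S ≥ v l` for some `l ≠ i` (here `2 ≤ m` enters) and `S ^ (-k)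
≥ exp (-S) / k!` leave a product of functions of single coordinates, whose factor at `i` has
infinite integral. -/
lemma lintegral_monomial_div_eq_top {m : ℕ} (hm : 2 ≤ m) (x : Fin m → ℕ) {i : Fin m}
    (hi : x i = 0) :
    ∫⁻ θ, ENNReal.ofReal ((∏ j, θ j ^ x j) / θ i) ∂(uniformSimplex m) = ∞ := by
  have : NeZero m := ⟨by omega⟩
  have : Nontrivial (Fin m) := Fin.nontrivial_iff_two_le.2 hm
  obtain ⟨l, hl⟩ := exists_ne i
  set y : Fin m → ℕ := incr x l with hy
  have hyi : y i = 0 := by simp [hy, incr, hi, hl.symm]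
  set k := ∑ j, x j with hk
  set f : Fin m → ℝ → ℝ := fun j u =>
    (if j = i then u⁻¹ else u ^ y j) * Real.exp (-u) with hf
  have hfm : ∀ j, Measurable (f j) := fun j => by
    by_cases hj : j = i
    · simp only [hf, hj, if_true]; fun_prop
    · simp only [hf, hj, if_false]; fun_prop
  have hprod : ∫⁻ v, ∏ j, ENNReal.ofReal (f j (v j)) ∂(expProd m) = ∞ := by
    rw [lintegral_expProd_prod (f := fun j u => ENNReal.ofReal (f j u))
      (fun j => (hfm j).ennreal_ofReal), ← Finset.mul_prod_erase _ _ (Finset.mem_univ i)]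
    have e : ∀ g : ℝ → ℝ, Measurable g → ∫⁻ u, ENNReal.ofReal (g u * Real.exp (-u)) ∂(expMeasure 1)
        = ∫⁻ u in Set.Ioi 0, ENNReal.ofReal (g u * Real.exp (-(2 * u))) := fun g hg => by
      rw [lintegral_expMeasure_one (by fun_prop)]
      refine lintegral_congr fun u => ?_
      rw [← ENNReal.ofReal_mul (Real.exp_pos _).le, mul_left_comm, ← Real.exp_add]
      congr 3
      ring
    have h1 : ∫⁻ u, ENNReal.ofReal (f i u) ∂(expMeasure 1) = ∞ := by
      simp only [hf, if_true]
      rw [e _ (by fun_prop), lintegral_inv_mul_exp_neg 2 two_pos]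
    rw [h1, ENNReal.top_mul]
    refine Finset.prod_ne_zero_iff.2 fun j hj => ?_
    simp only [hf, Finset.ne_of_mem_erase hj, if_false]
    rw [e _ (by fun_prop), lintegral_pow_mul_exp_neg _ two_pos]
    simp only [ne_eq, ENNReal.ofReal_eq_zero, not_le]
    positivity
  rw [uniformSimplex, lintegral_map (by fun_prop) (measurable_normalize m), eq_top_iff]
  calc ∞ = ENNReal.ofReal ((k.factorial : ℝ)⁻¹) * ∫⁻ v, ∏ j, ENNReal.ofReal (f j (v j)) ∂(expProd m) := by
        rw [hprod, ENNReal.mul_top]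
        simp only [ne_eq, ENNReal.ofReal_eq_zero, not_le]
        positivity
    _ = ∫⁻ v, ENNReal.ofReal ((k.factorial : ℝ)⁻¹) * ∏ j, ENNReal.ofReal (f j (v j)) ∂(expProd m) := by
        rw [lintegral_const_mul]
        exact Finset.measurable_fun_prod _ fun j _ =>
          ((hfm j).comp (measurable_pi_apply j)).ennreal_ofReal
    _ ≤ _ := by
        refine lintegral_mono_ae ?_
        filter_upwards [ae_pos_expProd m] with v hv
        have hS : 0 < ∑ j, v j := Finset.sum_pos (fun i _ => hv i) Finset.univ_nonempty
        have hf0 : ∀ j, 0 ≤ f j (v j) := fun j => by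
          have := hv j
          simp only [hf]
          split_ifs <;> positivity
        rw [← ENNReal.ofReal_prod_of_nonneg (fun j _ => hf0 j), ← ENNReal.ofReal_mul (by positivity)]
        refine ENNReal.ofReal_le_ofReal ?_
        have e1 : ∏ j, f j (v j) = v l * (∏ j, v j ^ x j) / v i * Real.exp (-∑ j, v j) := by
          have : ∀ j, (if j = i then (v j)⁻¹ else v j ^ y j) =
              v j ^ y j * (if j = i then (v i)⁻¹ else 1) := fun j => by
            by_cases hj : j = i
            · subst hj; simp [hyi]
            · simp [hj]
          simp only [hf]
          rw [Finset.prod_mul_distrib, ← Real.exp_sum, Finset.sum_neg_distrib,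
            Finset.prod_congr rfl fun j _ => this j, Finset.prod_mul_distrib,
            Finset.prod_ite_eq' Finset.univ i, if_pos (Finset.mem_univ i), hy, prod_pow_incr,
            div_eq_mul_inv]
        have e2 : (∏ j, normalize v j ^ x j) / normalize v i =
            (∏ j, v j ^ x j) / v i * ((∑ j, v j) / (∑ j, v j) ^ k) := by
          simp only [normalize, div_pow, Finset.prod_div_distrib, Finset.prod_pow_eq_pow_sum, ← hk]
          have := (hv i).ne'
          field_simp
        have hP : 0 < (∏ j, v j ^ x j) / v i :=
          div_pos (Finset.prod_pos fun j _ => pow_pos (hv j) _) (hv i)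
        have hl' : v l ≤ ∑ j, v j :=
          Finset.single_le_sum (fun j _ => (hv j).le) (Finset.mem_univ l)
        have hexp : (k.factorial : ℝ)⁻¹ * Real.exp (-∑ j, v j) ≤ ((∑ j, v j) ^ k)⁻¹ := by
          rw [Real.exp_neg, ← mul_inv]
          refine inv_anti₀ (by positivity) ?_
          have := Real.pow_div_factorial_le_exp _ hS.le k
          rwa [div_le_iff₀' (by positivity)] at this
        rw [e1, e2]
        calc (k.factorial : ℝ)⁻¹ * (v l * (∏ j, v j ^ x j) / v i * Real.exp (-∑ j, v j))
            = (∏ j, v j ^ x j) / v i * (v l * ((k.factorial : ℝ)⁻¹ * Real.exp (-∑ j, v j))) := by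
              ring
          _ ≤ (∏ j, v j ^ x j) / v i * ((∑ j, v j) * ((∑ j, v j) ^ k)⁻¹) := by
              gcongr

/-! ### Posterior loss for a uniform direction -/

/-- The posterior expected loss of the coordinate `d` at the total mean `L`, when the direction of
the parameter has the uniform distribution on the simplex. -/
noncomputable def posteriorLoss {m : ℕ} (x : Fin m → ℕ) (i : Fin m) (L d : ℝ) : ℝ :=
  d ^ 2 * ((∑ j, x j : ℕ) + m - 1) / (x i * L) - 2 * d +
    L * (x i + 1) / ((∑ j, x j : ℕ) + m)

lemma ae_lossTerm_nonneg {m : ℕ} (hm : 0 < m) (x : Fin m → ℕ) (i : Fin m) {L : ℝ} (hL : 0 < L)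
    (d : ℝ) :
    0 ≤ᵐ[uniformSimplex m] fun θ => (d - L * θ i) ^ 2 / (L * θ i) * ∏ j, θ j ^ x j := by
  filter_upwards [ae_uniformSimplex hm, ae_monomial_nonneg hm x] with θ hθ h
  exact mul_nonneg (div_nonneg (sq_nonneg _) (mul_nonneg hL.le (hθ.1 i).le)) h

lemma exists_eq_incr {m : ℕ} {x : Fin m → ℕ} {i : Fin m} (hi : x i ≠ 0) : ∃ y, x = incr y i := by
  refine ⟨x - Pi.single i 1, ?_⟩
  ext j
  by_cases hj : j = i
  · subst hj
    simp [incr]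
    omega
  · simp [incr, hj]

/-- The expected loss of one coordinate, weighted by a monomial likelihood. -/
lemma hasIntegral_lossTerm {m : ℕ} (hm : 2 ≤ m) (x : Fin m → ℕ) (i : Fin m) {L d : ℝ} (hL : 0 < L)
    (hd : x i = 0 → d = 0) :
    Integrable (fun θ => (d - L * θ i) ^ 2 / (L * θ i) * ∏ j, θ j ^ x j) (uniformSimplex m) ∧
    ∫ θ, (d - L * θ i) ^ 2 / (L * θ i) * ∏ j, θ j ^ x j ∂(uniformSimplex m) =
      (∏ j, ((x j).factorial : ℝ)) * mixtureWeight m (∑ j, x j) * posteriorLoss x i L d := by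
  have hm0 : 0 < m := by omega
  have hup : ∫ θ, ∏ j, θ j ^ incr x i j ∂(uniformSimplex m) = (∏ j, ((x j).factorial : ℝ)) *
      mixtureWeight m (∑ j, x j) * ((x i + 1) / ((∑ j, x j : ℕ) + m)) := by
    have : ((∑ j, x j : ℕ) : ℝ) + m ≠ 0 := by positivity
    rw [integral_monomial hm0, prod_factorial_incr, sum_incr, mixtureWeight_succ hm0 (∑ j, x j)]
    field_simp
  -- If `x i = 0`, the first term of `posteriorLoss` is a division by zero, hence zero, which is the
  -- correct value because `d = 0`.
  by_cases hi : x i = 0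
  · have he : (fun θ => (d - L * θ i) ^ 2 / (L * θ i) * ∏ j, θ j ^ x j) =ᵐ[uniformSimplex m]
        fun θ => L * ∏ j, θ j ^ incr x i j := by
      filter_upwards [ae_uniformSimplex hm0] with θ hθ
      have := hθ.1 i
      rw [hd hi, prod_pow_incr]
      field_simp
      ring
    refine ⟨(integrable_congr he).2 ((integrable_monomial hm0 _).const_mul _), ?_⟩
    rw [integral_congr_ae he, integral_const_mul, hup, posteriorLoss, hd hi, hi]
    ring
  · obtain ⟨y, rfl⟩ := exists_eq_incr hi
    have he : (fun θ => (d - L * θ i) ^ 2 / (L * θ i) * ∏ j, θ j ^ incr y i j)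
        =ᵐ[uniformSimplex m] fun θ => d ^ 2 / L * (∏ j, θ j ^ y j)
          - 2 * d * (∏ j, θ j ^ incr y i j) + L * ∏ j, θ j ^ incr (incr y i) i j := by
      filter_upwards [ae_uniformSimplex hm0] with θ hθ
      have := hθ.1 i
      rw [prod_pow_incr (incr y i), prod_pow_incr]
      field_simp
      ring
    have i1 := (integrable_monomial hm0 y).const_mul (d ^ 2 / L)
    have i2 := (integrable_monomial hm0 (incr y i)).const_mul (2 * d)
    have i3 := (integrable_monomial hm0 (incr (incr y i) i)).const_mul L
    have i12 : Integrable (fun θ => d ^ 2 / L * (∏ j, θ j ^ y j)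
      - 2 * d * (∏ j, θ j ^ incr y i j)) (uniformSimplex m) := i1.sub i2
    refine ⟨(integrable_congr he).2 (i12.add i3), ?_⟩
    rw [integral_congr_ae he, integral_add i12 i3, integral_sub i1 i2, integral_const_mul,
      integral_const_mul, integral_const_mul, hup, integral_monomial hm0, integral_monomial hm0,
      posteriorLoss, sum_incr, prod_factorial_incr, mixtureWeight_succ hm0 (∑ j, y j)]
    have e : ((incr y i i : ℕ) : ℝ) = y i + 1 := by simp [incr]
    rw [e]
    push_cast
    field_simp
    ring

lemma posteriorLoss_nonneg {m : ℕ} (hm : 2 ≤ m) (x : Fin m → ℕ) (i : Fin m) {L d : ℝ} (hL : 0 < L)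
    (hd : x i = 0 → d = 0) : 0 ≤ posteriorLoss x i L d := by
  have h := integral_nonneg_of_ae (ae_lossTerm_nonneg (by omega) x i hL d)
  rw [(hasIntegral_lossTerm hm x i hL hd).2] at h
  exact nonneg_of_mul_nonneg_right h (mul_pos (by positivity) (mixtureWeight_pos _ _))

lemma lintegral_lossTerm {m : ℕ} (hm : 2 ≤ m) (x : Fin m → ℕ) (i : Fin m) {L d : ℝ} (hL : 0 < L)
    (hd : x i = 0 → d = 0) :
    ∫⁻ θ, ENNReal.ofReal ((d - L * θ i) ^ 2 / (L * θ i) * ∏ j, θ j ^ x j) ∂(uniformSimplex m) =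
      ENNReal.ofReal
        ((∏ j, ((x j).factorial : ℝ)) * mixtureWeight m (∑ j, x j) * posteriorLoss x i L d) := by
  obtain ⟨h1, h2⟩ := hasIntegral_lossTerm hm x i hL hd
  rw [← h2, ofReal_integral_eq_lintegral_ofReal h1 (ae_lossTerm_nonneg (by omega) x i hL d)]

lemma lintegral_lossTerm_eq_top {m : ℕ} (hm : 2 ≤ m) {x : Fin m → ℕ} {i : Fin m} {L d : ℝ}
    (hL : 0 < L) (hi : x i = 0) (hd : d ≠ 0) :
    ∫⁻ θ, ENNReal.ofReal ((d - L * θ i) ^ 2 / (L * θ i) * ∏ j, θ j ^ x j) ∂(uniformSimplex m) =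
      ∞ := by
  have hm0 : 0 < m := by omega
  have hc : 0 < d ^ 2 / L := by positivity
  -- Expanding the square, only the term `d ^ 2 / (L * θ i)` is singular; the negative part of the
  -- cross term is moved to the other side, where its integral is finite.
  have h1 : ENNReal.ofReal (d ^ 2 / L) *
      ∫⁻ θ, ENNReal.ofReal ((∏ j, θ j ^ x j) / θ i) ∂(uniformSimplex m) ≤
      ∫⁻ θ, ENNReal.ofReal ((d - L * θ i) ^ 2 / (L * θ i) * ∏ j, θ j ^ x j) ∂(uniformSimplex m) +
      ENNReal.ofReal (2 * |d|) * ∫⁻ θ, ENNReal.ofReal (∏ j, θ j ^ x j) ∂(uniformSimplex m) := by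
    rw [← lintegral_const_mul _ (by fun_prop), ← lintegral_const_mul _ (by fun_prop),
      ← lintegral_add_right _ (by fun_prop)]
    refine lintegral_mono_ae ?_
    filter_upwards [ae_uniformSimplex hm0, ae_monomial_nonneg hm0 x,
      ae_lossTerm_nonneg hm0 x i hL d] with θ hθ hP hn
    simp only [Pi.zero_apply] at hP hn
    rw [← ENNReal.ofReal_mul hc.le, ← ENNReal.ofReal_mul (by positivity),
      ← ENNReal.ofReal_add hn (mul_nonneg (by positivity) hP)]
    refine ENNReal.ofReal_le_ofReal ?_
    have hθi := hθ.1 i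
    have e : (d - L * θ i) ^ 2 / (L * θ i) * ∏ j, θ j ^ x j =
        d ^ 2 / L * ((∏ j, θ j ^ x j) / θ i) - 2 * d * (∏ j, θ j ^ x j)
          + L * θ i * ∏ j, θ j ^ x j := by
      field_simp
      ring
    rw [e]
    have h2 : 0 ≤ L * θ i * ∏ j, θ j ^ x j := mul_nonneg (by positivity) hP
    nlinarith [mul_nonneg (sub_nonneg.2 (le_abs_self d)) hP]
  rw [lintegral_monomial_div_eq_top hm x hi, ENNReal.mul_top (by simpa using hc),
    top_le_iff, ENNReal.add_eq_top] at h1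
  refine h1.resolve_right ?_
  rw [lintegral_monomial hm0]
  exact ENNReal.mul_ne_top ENNReal.ofReal_ne_top ENNReal.ofReal_ne_top

/-! ### The averaged risk as a series in the total mean -/

lemma sampleLaw_singleton {m : ℕ} {l : Fin m → ℝ} (hl : l ∈ paramSpace m) (s : Sample m) :
    sampleLaw l {s} = ENNReal.ofReal (Real.exp (-(2 * ∑ i, l i)) * (∑ i, l i) ^ s.2 /
      ((∏ i, ((s.1 i).factorial : ℝ)) * s.2.factorial) * ∏ i, l i ^ s.1 i) := by
  have hl' : ∀ i, 0 ≤ l i := fun i => (hl i).le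
  have hS : 0 ≤ ∑ i, l i := Finset.sum_nonneg fun i _ => hl' i
  obtain ⟨x, y⟩ := s
  rw [sampleLaw, ← Set.singleton_prod_singleton, Measure.prod_prod, Measure.pi_singleton]
  simp only [poissonMeasure_singleton, Real.coe_toNNReal _ hS, Real.coe_toNNReal _ (hl' _)]
  rw [← ENNReal.ofReal_prod_of_nonneg (fun i _ => by have := hl' i; positivity),
    ← ENNReal.ofReal_mul (Finset.prod_nonneg fun i _ => by have := hl' i; positivity)]
  congr 1
  rw [Finset.prod_div_distrib, Finset.prod_mul_distrib, ← Real.exp_sum, Finset.sum_neg_distrib,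
    two_mul, neg_add, Real.exp_add]
  field_simp

/-- The expectation of a statistic under the parameter `L • θ`, with `θ` in the simplex. -/
lemma lintegral_sampleLaw_smul {m : ℕ} {L : ℝ} (hL : 0 < L) {θ : Fin m → ℝ}
    (hθ : (∀ i, 0 < θ i) ∧ ∑ i, θ i = 1) (f : Sample m → ℝ≥0∞) :
    ∫⁻ s, f s ∂(sampleLaw (L • θ)) = ∑' s : Sample m, f s * (ENNReal.ofReal
      (Real.exp (-(2 * L)) * L ^ (∑ i, s.1 i + s.2) /
        ((∏ i, ((s.1 i).factorial : ℝ)) * s.2.factorial)) *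
      ENNReal.ofReal (∏ i, θ i ^ s.1 i)) := by
  have hmem : L • θ ∈ paramSpace m := fun i => mul_pos hL (hθ.1 i)
  rw [lintegral_countable']
  refine tsum_congr fun s => ?_
  rw [sampleLaw_singleton hmem, ← ENNReal.ofReal_mul (by positivity)]
  congr 2
  simp only [Pi.smul_apply, smul_eq_mul, ← Finset.mul_sum, hθ.2, mul_one, mul_pow,
    Finset.prod_mul_distrib, Finset.prod_pow_eq_pow_sum, pow_add]
  ring

/-- The probability of the outcome `s` under the uniform mixture over the parameters with sum `L`,
up to the factor `exp (-2L) * L ^ n`, where `n` is the total count. -/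
noncomputable def outcomeWeight {m : ℕ} (s : Sample m) : ℝ :=
  mixtureWeight m (∑ i, s.1 i) / s.2.factorial

lemma outcomeWeight_pos {m : ℕ} (s : Sample m) : 0 < outcomeWeight s :=
  div_pos (mixtureWeight_pos _ _) (by positivity)

/-- The total posterior loss of the action `d`. -/
noncomputable def totalPosteriorLoss {m : ℕ} (d : Fin m → ℝ) (x : Fin m → ℕ) (L : ℝ) : ℝ :=
  ∑ i, posteriorLoss x i L (d i)

/-- A mixture of probability measures has total mass one. -/
lemma hasSum_outcomeWeight {m : ℕ} (hm : 0 < m) {L : ℝ} (hL : 0 < L) :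
    HasSum (fun s : Sample m => outcomeWeight s * L ^ (∑ i, s.1 i + s.2)) (Real.exp (2 * L)) := by
  have h : ∑' s : Sample m, ENNReal.ofReal
      (Real.exp (-(2 * L)) * (outcomeWeight s * L ^ (∑ i, s.1 i + s.2))) = 1 := by
    have h1 : ∫⁻ θ, ∫⁻ _ : Sample m, 1 ∂(sampleLaw (L • θ)) ∂(uniformSimplex m) = 1 := by
      have : ∀ l : Fin m → ℝ, IsProbabilityMeasure (sampleLaw l) := fun l => by
        unfold sampleLaw
        infer_instance
      simp
    rw [lintegral_congr_ae ((ae_uniformSimplex hm).mono fun θ hθ =>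
      lintegral_sampleLaw_smul hL hθ _), lintegral_tsum (fun s =>
        (by fun_prop : Measurable _).aemeasurable)] at h1
    rw [← h1]
    refine tsum_congr fun s => ?_
    simp only [one_mul]
    rw [lintegral_const_mul _ (by fun_prop), lintegral_monomial hm,
      ← ENNReal.ofReal_mul (by positivity), outcomeWeight]
    congr 1
    field_simp
  have h0 : ∀ s : Sample m, 0 ≤ Real.exp (-(2 * L)) *
      (outcomeWeight s * L ^ (∑ i, s.1 i + s.2)) := fun s => by
    have := outcomeWeight_pos s
    positivity
  have hs : Summable fun s : Sample m => Real.exp (-(2 * L)) *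
      (outcomeWeight s * L ^ (∑ i, s.1 i + s.2)) := by
    have := ENNReal.summable_toReal (h.trans_ne ENNReal.one_ne_top)
    simpa only [ENNReal.toReal_ofReal (h0 _)] using this
  have h2 := hs.hasSum
  rw [← ENNReal.ofReal_tsum_of_nonneg h0 hs, ENNReal.ofReal_eq_one] at h
  rw [h] at h2
  convert! h2.mul_left (Real.exp (2 * L)) using 1
  · ext s
    rw [← mul_assoc, ← Real.exp_add]
    simp
  · simp

lemma measurable_loss {m : ℕ} (d : Fin m → ℝ) (L : ℝ) :
    Measurable fun θ : Fin m → ℝ => loss d (L • θ) := by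
  unfold loss
  simp only [Pi.smul_apply]
  fun_prop

lemma lintegral_risk {m : ℕ} (hm : 2 ≤ m) (δ : Estimator m) {L : ℝ} (hL : 0 < L) :
    ∫⁻ θ, risk δ (L • θ) ∂(uniformSimplex m) = ∑' s : Sample m, ENNReal.ofReal
      (Real.exp (-(2 * L)) * L ^ (∑ i, s.1 i + s.2) /
        ((∏ i, ((s.1 i).factorial : ℝ)) * s.2.factorial)) * ∑ i, ∫⁻ θ, ENNReal.ofReal
        ((δ s i - L * θ i) ^ 2 / (L * θ i) * ∏ j, θ j ^ s.1 j) ∂(uniformSimplex m) := by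
  have hm0 : 0 < m := by omega
  have hmeas := fun s : Sample m => (measurable_loss (δ s) L).ennreal_ofReal
  simp only [risk]
  rw [lintegral_congr_ae ((ae_uniformSimplex hm0).mono fun θ hθ =>
    lintegral_sampleLaw_smul hL hθ _), lintegral_tsum (fun s =>
      (by fun_prop : Measurable _).aemeasurable)]
  refine tsum_congr fun s => ?_
  rw [← lintegral_finsetSum _ (fun i _ => by fun_prop), ← lintegral_const_mul _ (by fun_prop)]
  refine lintegral_congr_ae ?_
  filter_upwards [ae_uniformSimplex hm0, ae_monomial_nonneg hm0 s.1,
    ae_all_iff.2 fun i => ae_lossTerm_nonneg hm0 s.1 i hL (δ s i)] with θ hθ hP hn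
  have hl : 0 ≤ loss (δ s) (L • θ) := Finset.sum_nonneg fun i _ =>
    div_nonneg (sq_nonneg _) (mul_nonneg hL.le (hθ.1 i).le)
  rw [mul_left_comm, ← ENNReal.ofReal_mul hl, ← ENNReal.ofReal_sum_of_nonneg (fun i _ => hn i),
    loss, Finset.sum_mul]
  simp only [Pi.smul_apply, smul_eq_mul]

/-- The average risk of an estimator that vanishes where the observed coordinate does. -/
lemma lintegral_risk_eq_tsum {m : ℕ} (hm : 2 ≤ m) {δ : Estimator m}
    (hδ : ∀ s i, s.1 i = 0 → δ s i = 0) {L : ℝ} (hL : 0 < L) :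
    ∫⁻ θ, risk δ (L • θ) ∂(uniformSimplex m) = ∑' s : Sample m, ENNReal.ofReal
      (Real.exp (-(2 * L)) * (outcomeWeight s * L ^ (∑ i, s.1 i + s.2)) *
        totalPosteriorLoss (δ s) s.1 L) := by
  rw [lintegral_risk hm δ hL]
  refine tsum_congr fun s => ?_
  have hw := mixtureWeight_pos m (∑ j, s.1 j)
  rw [Finset.sum_congr rfl fun i _ => lintegral_lossTerm hm s.1 i hL (hδ s i),
    ← ENNReal.ofReal_sum_of_nonneg fun i _ => mul_nonneg (by positivity)
      (posteriorLoss_nonneg hm s.1 i hL (hδ s i)), ← ENNReal.ofReal_mul (by positivity),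
    ← Finset.mul_sum, totalPosteriorLoss, outcomeWeight]
  congr 1
  field_simp

/-- An estimator of finite average risk vanishes where the observed coordinate does. -/
lemma eq_zero_of_lintegral_risk_ne_top {m : ℕ} (hm : 2 ≤ m) {δ : Estimator m} {L : ℝ}
    (hL : 0 < L) (h : ∫⁻ θ, risk δ (L • θ) ∂(uniformSimplex m) ≠ ∞) (s : Sample m) (i : Fin m)
    (hi : s.1 i = 0) : δ s i = 0 := by
  by_contra hd
  rw [lintegral_risk hm δ hL] at h
  refine ENNReal.ne_top_of_tsum_ne_top h s ?_
  rw [ENNReal.sum_eq_top.2 ⟨i, Finset.mem_univ i, lintegral_lossTerm_eq_top hm hL hi hd⟩,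
    ENNReal.mul_top]
  simp only [ne_eq, ENNReal.ofReal_eq_zero, not_le]
  positivity

lemma shrinkageEstimator_eq_zero {m : ℕ} (s : Sample m) (i : Fin m) (hi : s.1 i = 0) :
    shrinkageEstimator m s i = 0 := by
  simp [shrinkageEstimator, hi]

lemma shrinkageEstimator_mul {m : ℕ} (hm : 2 ≤ m) (s : Sample m) (i : Fin m) :
    shrinkageEstimator m s i * ((∑ j, s.1 j : ℕ) + m - 1) =
      ((∑ j, s.1 j + s.2 : ℕ) : ℝ) / 2 * s.1 i := by
  have hm' : (2 : ℝ) ≤ m := by exact_mod_cast hm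
  have hpos : (0 : ℝ) < (∑ j, s.1 j : ℕ) + m - 1 := by
    have : (0 : ℝ) ≤ (∑ j, s.1 j : ℕ) := by positivity
    linarith
  rw [shrinkageEstimator, mul_assoc, div_mul_cancel₀ _ hpos.ne', Nat.cast_add]

lemma summable_totalPosteriorLoss {m : ℕ} {δ : Estimator m} (hm : 2 ≤ m)
    (hδ : ∀ s i, s.1 i = 0 → δ s i = 0) {L : ℝ} (hL : 0 < L)
    (h : ∫⁻ θ, risk δ (L • θ) ∂(uniformSimplex m) ≠ ∞) :
    Summable fun s : Sample m => outcomeWeight s * L ^ (∑ i, s.1 i + s.2) *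
        totalPosteriorLoss (δ s) s.1 L := by
  rw [lintegral_risk_eq_tsum hm hδ hL] at h
  have := (ENNReal.summable_toReal h).mul_left (Real.exp (2 * L))
  refine this.congr fun s => ?_
  have hw := outcomeWeight_pos s
  have hp : 0 ≤ totalPosteriorLoss (δ s) s.1 L :=
    Finset.sum_nonneg fun i _ => posteriorLoss_nonneg hm s.1 i hL (hδ s i)
  rw [ENNReal.toReal_ofReal (by positivity), mul_assoc, ← mul_assoc, ← Real.exp_add]
  simp

lemma lintegral_risk_eq_ofReal {m : ℕ} {δ : Estimator m} (hm : 2 ≤ m)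
    (hδ : ∀ s i, s.1 i = 0 → δ s i = 0) {L : ℝ} (hL : 0 < L)
    (h : Summable fun s : Sample m => outcomeWeight s * L ^ (∑ i, s.1 i + s.2) *
        totalPosteriorLoss (δ s) s.1 L) :
    ∫⁻ θ, risk δ (L • θ) ∂(uniformSimplex m) = ENNReal.ofReal (Real.exp (-(2 * L)) *
      ∑' s : Sample m, outcomeWeight s * L ^ (∑ i, s.1 i + s.2) *
        totalPosteriorLoss (δ s) s.1 L) := by
  rw [lintegral_risk_eq_tsum hm hδ hL, ← tsum_mul_left, ENNReal.ofReal_tsum_of_nonneg _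
    (h.mul_left _)]
  · exact tsum_congr fun s => by rw [mul_assoc]
  · intro s
    have hw := outcomeWeight_pos s
    have hp : 0 ≤ totalPosteriorLoss (δ s) s.1 L :=
      Finset.sum_nonneg fun i _ => posteriorLoss_nonneg hm s.1 i hL (hδ s i)
    positivity

lemma sum_posterior_mean {m : ℕ} (hm : 0 < m) (x : Fin m → ℕ) (L : ℝ) :
    ∑ i, L * ((x i : ℝ) + 1) / ((∑ j, x j : ℕ) + m) = L := by
  have : ((∑ j, x j : ℕ) : ℝ) + m ≠ 0 := by positivity
  rw [← Finset.sum_div, ← Finset.mul_sum, Finset.sum_add_distrib, ← Nat.cast_sum]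
  simp only [Finset.sum_const, Finset.card_univ, Fintype.card_fin, nsmul_eq_mul, mul_one]
  field_simp

lemma totalPosteriorLoss_shrinkage_le {m : ℕ} (hm : 2 ≤ m) (s : Sample m) {L : ℝ} (hL : 0 < L) :
    totalPosteriorLoss (shrinkageEstimator m s) s.1 L ≤
      ((∑ j, s.1 j + s.2 : ℕ) : ℝ) ^ 2 / (4 * L) + L := by
  have hm' : (2 : ℝ) ≤ m := by exact_mod_cast hm
  set k : ℝ := ((∑ j, s.1 j : ℕ) : ℝ) with hk
  set z : ℝ := ((∑ j, s.1 j + s.2 : ℕ) : ℝ) with hz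
  have hk0 : 0 ≤ k := by positivity
  have hpos : 0 < k + m - 1 := by linarith
  have hterm : ∀ i, posteriorLoss s.1 i L (shrinkageEstimator m s i) ≤
      z ^ 2 / (4 * L) / (k + m - 1) * s.1 i + L * ((s.1 i : ℝ) + 1) / (k + m) := fun i => by
    have he : shrinkageEstimator m s i = z / 2 * s.1 i / (k + m - 1) := by
      rw [eq_div_iff hpos.ne']
      exact shrinkageEstimator_mul hm s i
    have h0 : 0 ≤ shrinkageEstimator m s i := by rw [he]; positivity
    have h1 : shrinkageEstimator m s i ^ 2 * (k + m - 1) / (s.1 i * L) =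
        z ^ 2 / (4 * L) / (k + m - 1) * s.1 i := by
      rcases Nat.eq_zero_or_pos (s.1 i) with hi | hi
      · simp [hi]
      · have : (s.1 i : ℝ) ≠ 0 := by positivity
        rw [he]
        field_simp
        ring
    rw [posteriorLoss, ← hk, h1]
    linarith
  refine (Finset.sum_le_sum fun i _ => hterm i).trans ?_
  rw [Finset.sum_add_distrib, hk, sum_posterior_mean (by omega) s.1 L, ← Finset.mul_sum,
    ← Nat.cast_sum, ← hk]
  gcongr
  rw [div_mul_eq_mul_div, div_le_iff₀ hpos]
  gcongr
  linarith

lemma summable_shrinkage {m : ℕ} (hm : 2 ≤ m) {L : ℝ} (hL : 0 < L) :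
    Summable fun s : Sample m => outcomeWeight s * L ^ (∑ i, s.1 i + s.2) *
        totalPosteriorLoss (shrinkageEstimator m s) s.1 L := by
  -- The posterior loss grows at most like `n ^ 2 ≤ 4 ^ n`, so the series is compared with the one
  -- at `4 * L`.
  have h1 := ((hasSum_outcomeWeight (m := m) (by omega)
    (by positivity : 0 < 4 * L)).summable).mul_left (1 / (4 * L))
  have h2 := ((hasSum_outcomeWeight (m := m) (by omega) hL).summable).mul_left L
  refine Summable.of_nonneg_of_le (fun s => ?_) (fun s => ?_) (h1.add h2)
  · have hw := outcomeWeight_pos s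
    have hp : 0 ≤ totalPosteriorLoss (shrinkageEstimator m s) s.1 L :=
      Finset.sum_nonneg fun i _ =>
        posteriorLoss_nonneg hm s.1 i hL (shrinkageEstimator_eq_zero s i)
    positivity
  · have hw := outcomeWeight_pos s
    have h3 : ((∑ j, s.1 j + s.2 : ℕ) : ℝ) ^ 2 ≤ 4 ^ (∑ j, s.1 j + s.2) := by
      have : ((∑ j, s.1 j + s.2 : ℕ) : ℝ) ≤ 2 ^ (∑ j, s.1 j + s.2) := by
        exact_mod_cast Nat.lt_two_pow_self.le
      calc _ ≤ ((2 : ℝ) ^ (∑ j, s.1 j + s.2)) ^ 2 := by gcongr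
        _ = 4 ^ (∑ j, s.1 j + s.2) := by rw [pow_right_comm]; norm_num
    calc _ ≤ outcomeWeight s * L ^ (∑ i, s.1 i + s.2) *
          (4 ^ (∑ j, s.1 j + s.2) / (4 * L) + L) := by
          gcongr
          exact (totalPosteriorLoss_shrinkage_le hm s hL).trans (by gcongr)
      _ = _ := by
          rw [mul_pow]
          ring

/-! ### Comparison with the shrinkage estimator -/

/-- The weighted squared distance of an action to the shrinkage estimate. -/
noncomputable def sqDistance {m : ℕ} (d : Fin m → ℝ) (s : Sample m) : ℝ :=
  ∑ i, (d i - shrinkageEstimator m s i) ^ 2 * ((∑ j, s.1 j : ℕ) + m - 1) / s.1 i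

/-- Expand the quadratic around the estimate `e`. By `shrinkageEstimator_mul`, the derivative of the
loss of each coordinate at `e` is `n / L - 2`, the same for every observed coordinate, so the linear
terms see only the sum of the differences. -/
lemma totalPosteriorLoss_sub {m : ℕ} (hm : 2 ≤ m) {d : Fin m → ℝ} {s : Sample m}
    (hd : ∀ i, s.1 i = 0 → d i = 0) {L : ℝ} (hL : 0 < L) :
    totalPosteriorLoss d s.1 L - totalPosteriorLoss (shrinkageEstimator m s) s.1 L =
      (sqDistance d s + (((∑ j, s.1 j + s.2 : ℕ) : ℝ) - 2 * L) *
        ∑ i, (d i - shrinkageEstimator m s i)) / L := by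
  rw [totalPosteriorLoss, totalPosteriorLoss, ← Finset.sum_sub_distrib, sqDistance, Finset.mul_sum,
    ← Finset.sum_add_distrib, Finset.sum_div]
  refine Finset.sum_congr rfl fun i _ => ?_
  have h := shrinkageEstimator_mul hm s i
  simp only [posteriorLoss]
  rcases Nat.eq_zero_or_pos (s.1 i) with hi | hi
  · simp [hi, hd i hi, shrinkageEstimator_eq_zero s i hi]
  · have : (s.1 i : ℝ) ≠ 0 := by positivity
    set e := shrinkageEstimator m s i
    field_simp
    linear_combination 2 * (d i - e) * ((∑ j, s.1 j : ℕ) + m) * h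

/-- Parallelogram identity for the quadratic `posteriorLoss`, whose value at the midpoint is
nonnegative. It gives summability of `sqDistance` from finiteness of both averaged risks. -/
lemma sqDistance_div_le {m : ℕ} (hm : 2 ≤ m) {d : Fin m → ℝ} {s : Sample m}
    (hd : ∀ i, s.1 i = 0 → d i = 0) {L : ℝ} (hL : 0 < L) :
    sqDistance d s ≤ 2 * L * (totalPosteriorLoss d s.1 L +
      totalPosteriorLoss (shrinkageEstimator m s) s.1 L) := by
  rw [totalPosteriorLoss, totalPosteriorLoss, ← Finset.sum_add_distrib, Finset.mul_sum, sqDistance]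
  refine Finset.sum_le_sum fun i _ => ?_
  set e := shrinkageEstimator m s i with he
  have h := posteriorLoss_nonneg hm s.1 i (L := L) (d := (d i + e) / 2) hL fun hi => by
    rw [hd i hi, he, shrinkageEstimator_eq_zero s i hi]
    norm_num
  have e1 : 2 * L * (posteriorLoss s.1 i L (d i) + posteriorLoss s.1 i L e) =
      (d i - e) ^ 2 * ((∑ j, s.1 j : ℕ) + m - 1) / s.1 i
        + 4 * L * posteriorLoss s.1 i L ((d i + e) / 2) := by
    simp only [posteriorLoss]
    rcases Nat.eq_zero_or_pos (s.1 i) with hi | hi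
    · simp [hi]
      ring
    · have : (s.1 i : ℝ) ≠ 0 := by positivity
      field_simp
      ring
  rw [e1]
  have : 0 ≤ 4 * L * posteriorLoss s.1 i L ((d i + e) / 2) := by positivity
  linarith

/-- Cauchy-Schwarz with weights `x i`, whose sum `k` is at most `k + m - 1`. Coordinates with `x i =
0` contribute nothing since both estimates vanish there. -/
lemma sq_sum_sub_le_sqDistance {m : ℕ} (hm : 2 ≤ m) {d : Fin m → ℝ} {s : Sample m}
    (hd : ∀ i, s.1 i = 0 → d i = 0) :
    (∑ i, (d i - shrinkageEstimator m s i)) ^ 2 ≤ sqDistance d s := by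
  have hm' : (2 : ℝ) ≤ m := by exact_mod_cast hm
  have h := Finset.sum_mul_sq_le_sq_mul_sq Finset.univ
    (fun i => (d i - shrinkageEstimator m s i) / √(s.1 i)) (fun i => √(s.1 i : ℝ))
  have e1 : ∀ i, (d i - shrinkageEstimator m s i) / √(s.1 i) * √(s.1 i : ℝ) =
      d i - shrinkageEstimator m s i := fun i => by
    rcases Nat.eq_zero_or_pos (s.1 i) with hi | hi
    · simp [hi, hd i hi, shrinkageEstimator_eq_zero s i hi]
    · exact div_mul_cancel₀ _ (by positivity)
  have hsq : ∀ i, √(s.1 i : ℝ) ^ 2 = s.1 i := fun i => Real.sq_sqrt (by positivity)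
  simp only [e1, div_pow, hsq, ← Nat.cast_sum] at h
  refine h.trans ?_
  rw [Finset.sum_mul, sqDistance]
  refine Finset.sum_le_sum fun i _ => ?_
  rw [div_mul_eq_mul_div]
  gcongr
  linarith

lemma eq_shrinkage_of_sqDistance_eq_zero {m : ℕ} (hm : 2 ≤ m) {d : Fin m → ℝ} {s : Sample m}
    (hd : ∀ i, s.1 i = 0 → d i = 0) (h : sqDistance d s = 0) :
    d = shrinkageEstimator m s := by
  have hm' : (2 : ℝ) ≤ m := by exact_mod_cast hm
  have hpos : (0 : ℝ) < (∑ j, s.1 j : ℕ) + m - 1 := by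
    have : (0 : ℝ) ≤ (∑ j, s.1 j : ℕ) := by positivity
    linarith
  ext i
  rcases Nat.eq_zero_or_pos (s.1 i) with hi | hi
  · rw [hd i hi, shrinkageEstimator_eq_zero s i hi]
  · have h1 := (Finset.sum_eq_zero_iff_of_nonneg fun i _ =>
      div_nonneg (mul_nonneg (sq_nonneg _) hpos.le) (by positivity)).1 h i (Finset.mem_univ i)
    have hi' : (s.1 i : ℝ) ≠ 0 := by positivity
    rw [div_eq_zero_iff, or_iff_left hi', mul_eq_zero, or_iff_left hpos.ne',
      sq_eq_zero_iff, sub_eq_zero] at h1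
    exact h1

/-- An estimator whose risk is nowhere larger than that of the shrinkage estimator equals it. -/
lemma eq_shrinkage_of_risk_le {m : ℕ} (hm : 2 ≤ m) {δ : Estimator m}
    (hδ : ∀ l ∈ paramSpace m, risk δ l ≤ risk (shrinkageEstimator m) l) :
    δ = shrinkageEstimator m := by
  have hm0 : 0 < m := by omega
  have hS0 : ∀ (s : Sample m) (i : Fin m), s.1 i = 0 → shrinkageEstimator m s i = 0 :=
    shrinkageEstimator_eq_zero
  have hle : ∀ L : ℝ, 0 < L → ∫⁻ θ, risk δ (L • θ) ∂(uniformSimplex m) ≤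
      ∫⁻ θ, risk (shrinkageEstimator m) (L • θ) ∂(uniformSimplex m) := fun L hL =>
    lintegral_mono_ae <| (ae_uniformSimplex hm0).mono fun θ hθ =>
      hδ _ fun i => mul_pos hL (hθ.1 i)
  have hfin : ∀ L : ℝ, 0 < L → ∫⁻ θ, risk δ (L • θ) ∂(uniformSimplex m) ≠ ∞ := fun L hL =>
    ne_top_of_le_ne_top (by
      rw [lintegral_risk_eq_ofReal hm hS0 hL (summable_shrinkage hm hL)]
      exact ENNReal.ofReal_ne_top) (hle L hL)
  -- The estimator does not depend on `L`, so a single value of `L` suffices.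
  have hδ0 : ∀ s i, s.1 i = 0 → δ s i = 0 :=
    eq_zero_of_lintegral_risk_ne_top hm one_pos (hfin 1 one_pos)
  have hsum := fun L (hL : 0 < L) => summable_totalPosteriorLoss hm hδ0 hL (hfin L hL)
  have hp : ∀ (s : Sample m) L, 0 < L → 0 ≤ totalPosteriorLoss (shrinkageEstimator m s) s.1 L :=
    fun s L hL => Finset.sum_nonneg fun i _ => posteriorLoss_nonneg hm s.1 i hL (hS0 s i)
  have hu0 : ∀ s, 0 ≤ sqDistance (δ s) s := fun s =>
    (sq_nonneg _).trans (sq_sum_sub_le_sqDistance hm (hδ0 s))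
  ext1 s
  refine eq_shrinkage_of_sqDistance_eq_zero hm (hδ0 s) ?_
  refine eq_zero_of_poisson_risk_nonpos (w := outcomeWeight)
    (t := fun s => ∑ i, (δ s i - shrinkageEstimator m s i)) (u := fun s => sqDistance (δ s) s)
    (n := fun s => ∑ i, s.1 i + s.2) outcomeWeight_pos
    (fun s => sq_sum_sub_le_sqDistance hm (hδ0 s)) (fun L hL => hasSum_outcomeWeight hm0 hL)
    (fun L hL => ?_) (fun L hL => ?_) s
  · refine Summable.of_nonneg_of_le (fun s => ?_) (fun s => ?_)
      (((hsum L hL).add (summable_shrinkage hm hL)).mul_left (2 * L))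
    · have := outcomeWeight_pos s
      have := hu0 s
      positivity
    · have hw : 0 < outcomeWeight s * L ^ (∑ i, s.1 i + s.2) :=
        mul_pos (outcomeWeight_pos s) (pow_pos hL _)
      have := mul_le_mul_of_nonneg_left (sqDistance_div_le hm (hδ0 s) hL) hw.le
      linarith
  · have h := hle L hL
    rw [lintegral_risk_eq_ofReal hm hS0 hL (summable_shrinkage hm hL),
      lintegral_risk_eq_ofReal hm hδ0 hL (hsum L hL), ENNReal.ofReal_le_ofReal_iff
      (mul_nonneg (Real.exp_pos _).le (tsum_nonneg fun s => mul_nonneg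
        (mul_pos (outcomeWeight_pos s) (pow_pos hL _)).le (hp s L hL)))] at h
    have h' := le_of_mul_le_mul_left h (Real.exp_pos _)
    have e : ∑' s : Sample m, outcomeWeight s * L ^ (∑ i, s.1 i + s.2) * (sqDistance (δ s) s +
        (((∑ j, s.1 j + s.2 : ℕ) : ℝ) - 2 * L) * ∑ i, (δ s i - shrinkageEstimator m s i)) =
        L * (∑' s : Sample m, outcomeWeight s * L ^ (∑ i, s.1 i + s.2) *
            totalPosteriorLoss (δ s) s.1 L -
          ∑' s : Sample m, outcomeWeight s * L ^ (∑ i, s.1 i + s.2) *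
            totalPosteriorLoss (shrinkageEstimator m s) s.1 L) := by
      rw [← (hsum L hL).tsum_sub (summable_shrinkage hm hL), ← tsum_mul_left]
      refine tsum_congr fun s => ?_
      rw [← mul_sub, totalPosteriorLoss_sub hm (hδ0 s) hL]
      field_simp
    exact e.trans_le (mul_nonpos_of_nonneg_of_nonpos hL.le (sub_nonpos.2 h'))

end PoissonEstimation

theorem theorem2p4 (m : ℕ) (hm : 2 ≤ m) :
    PoissonEstimation.IsAdmissible (PoissonEstimation.shrinkageEstimator m) := by
  rintro ⟨δ, hle, l, -, hlt⟩
  rw [PoissonEstimation.eq_shrinkage_of_risk_le hm hle] at hlt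
  exact lt_irrefl _ hlt
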